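/- Let $\mathbb N=\{0,1,2,\dots\}$, let $(c_n)_{n\in\mathbb N}$ be a sequence of complex numbers, and let $L^2[0,1]$ be the complex $L^2$-space of Lebesgue measure on $[0,1]$. An infinite matrix is called positive semidefinite if it is Hermitian and its quadratic form is non-negative on all finitely supported vectors. (i) The map $x^n\mapsto c_n x^n$ ($n\in\mathbb N$) extends to a bounded linear operator $T:L^2[0,1]\to L^2[0,1]$ with $\|T\|\le 1$ if and only if the infinite matrix $$\left[\frac{1-c_m\overline{c_n}}{1+m+n}\right]_{m,n\in\mathbb N}$$ is positive semidefinite. (ii) The map $x^n\mapsto c_n x^n$ ($n\in\mathbb N$) extends to a bounded linear operator on $L^2[0,1]$ if and only if there is a real number $M>0$ such that the matrix in (i) with $c_n/M$ in place of $c_n$ for all $n$, namely $\left[\frac{1-M^{-2}c_m\overline{c_n}}{1+m+n}\right]_{m,n\in\mathbb N}$, is positive semidefinite. (iii) If $T$ is a bounded linear operator on $L^2[0,1]$ with $Tx^n=c_nx^n$ for all $n\in\mathbb N$ and $T\ne 0$, then $T$ is not compact. -/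

import Mathlib

open MeasureTheory
open scoped ComplexOrder

/-- Lebesgue measure on the interval `[0,1]`, as a measure on the real line. -/
noncomputable abbrev unitMeasure : Measure ℝ := volume.restrict (Set.Icc (0 : ℝ) 1)

/-- The complex Hilbert space `L²[0,1]`. -/
noncomputable abbrev L2unit : Type := Lp ℂ 2 unitMeasure

theorem memLp_monomial (n : ℕ) : MemLp (fun x : ℝ => (x : ℂ) ^ n) 2 unitMeasure := by
  refine MemLp.of_bound (C := 1) ?_ ?_
  · exact (by fun_prop : Continuous fun x : ℝ => (x : ℂ) ^ n).aestronglyMeasurable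
  · filter_upwards [ae_restrict_mem measurableSet_Icc] with x hx
    rw [norm_pow, Complex.norm_real, Real.norm_of_nonneg hx.1]
    exact pow_le_one₀ hx.1 hx.2

/-- The monomial `x ^ n` as an element of `L²[0,1]`. -/
noncomputable def monomialL2 (n : ℕ) : L2unit := (memLp_monomial n).toLp

/-- The bounded operator `T` on `L²[0,1]` extends the map `x ^ n ↦ c n * x ^ n`, `n = 0, 1, 2, …`. -/
def ExtendsDiagonal (c : ℕ → ℂ) (T : L2unit →L[ℂ] L2unit) : Prop :=
  ∀ n : ℕ, T (monomialL2 n) = c n • monomialL2 n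

/-- The infinite Pick matrix with entries `(1 - c m * conj (c n)) / (1 + m + n)`. Mathlib's
`Matrix.PosSemidef` for an infinite index type is tested on finitely supported vectors. -/
noncomputable def pickMatrix (c : ℕ → ℂ) : Matrix ℕ ℕ ℂ :=
  Matrix.of fun m n => (1 - c m * star (c n)) / (1 + (m : ℂ) + (n : ℂ))

/-!
The matrix `pickMatrix c` is the transpose of the difference of the Gram matrices of `(xⁿ)` and of
`(cₙ xⁿ)`, so it is positive semidefinite exactly when `‖∑ aₙ cₙ xⁿ‖ ≤ ‖∑ aₙ xⁿ‖` for all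
polynomials; by Weierstrass the polynomials are dense, and the contraction extends.

For the failure of compactness, let `V_a f = a^(-1/2) 1_[0,a] f(· / a)`. These dilations are
isometries and `V_a† xⁿ = a^(n+1/2) xⁿ`, so `V_a†` commutes with `T` and tends strongly to `0` as
`a → 0`. Hence `T f = V_a† T V_a f`, where the vectors `T V_a f` stay in a compact set if `T` is
compact. Strong convergence of the contractions `V_a†` is uniform on that set, so `T f = 0`.
-/

open Filter Topology ContinuousLinearMap
open scoped Matrix InnerProduct InnerProductSpace Polynomial

section Gram

variable {𝕜 E F ι : Type*} [RCLike 𝕜] [NormedAddCommGroup E] [InnerProductSpace 𝕜 E]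
  [NormedAddCommGroup F] [InnerProductSpace 𝕜 F]

theorem sum_star_mul_gram_mul (v : ι → E) (x : ι →₀ 𝕜) :
    (x.sum fun i xi => x.sum fun j xj => star xi * Matrix.gram 𝕜 v i j * xj) =
      ((‖Finsupp.linearCombination 𝕜 v x‖ ^ 2 : ℝ) : 𝕜) := by
  rw [RCLike.ofReal_pow, ← inner_self_eq_norm_sq_to_K, Finsupp.linearCombination_apply]
  simp only [Finsupp.sum, sum_inner, inner_sum, inner_smul_left, inner_smul_right,
    Matrix.gram_apply, RCLike.star_def, Finset.mul_sum]
  exact Finset.sum_comm.trans (Finset.sum_congr rfl fun i _ => Finset.sum_congr rfl fun j _ => by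
    ring)

theorem posSemidef_gram_sub_gram_iff {v : ι → E} {w : ι → F} :
    (Matrix.gram 𝕜 v - Matrix.gram 𝕜 w).PosSemidef ↔ ∀ x : ι →₀ 𝕜,
      ‖Finsupp.linearCombination 𝕜 w x‖ ≤ ‖Finsupp.linearCombination 𝕜 v x‖ := by
  have quadraticForm (x : ι →₀ 𝕜) :
      (x.sum fun i xi => x.sum fun j xj => star xi * (Matrix.gram 𝕜 v - Matrix.gram 𝕜 w) i j * xj) =
        ((‖Finsupp.linearCombination 𝕜 v x‖ ^ 2 -
          ‖Finsupp.linearCombination 𝕜 w x‖ ^ 2 : ℝ) : 𝕜) := by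
    rw [RCLike.ofReal_sub, ← sum_star_mul_gram_mul, ← sum_star_mul_gram_mul]
    simp only [Matrix.sub_apply, mul_sub, sub_mul, Finsupp.sum_sub]
  simp only [Matrix.PosSemidef, quadraticForm, RCLike.ofReal_nonneg, sub_nonneg,
    sq_le_sq₀ (norm_nonneg _) (norm_nonneg _), and_iff_right_iff_imp]
  exact fun _ => (Matrix.isHermitian_gram 𝕜 v).sub (Matrix.isHermitian_gram 𝕜 w)

theorem denseRange_linearCombination_iff {v : ι → E} :
    DenseRange (Finsupp.linearCombination 𝕜 v) ↔
      Dense (Submodule.span 𝕜 (Set.range v) : Set E) := by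
  rw [← Finsupp.range_linearCombination, LinearMap.coe_range, DenseRange]

theorem apply_linearCombination_of_apply_eq {v : ι → E} {w : ι → F} {T : E →L[𝕜] F}
    (hT : ∀ i, T (v i) = w i) (x : ι →₀ 𝕜) :
    T (Finsupp.linearCombination 𝕜 v x) = Finsupp.linearCombination 𝕜 w x := by
  rw [← funext hT]
  exact Finsupp.apply_linearCombination 𝕜 (T : E →ₗ[𝕜] F) v x

theorem exists_opNorm_le_one_iff_posSemidef_gram_sub_gram [CompleteSpace F] {v : ι → E}
    {w : ι → F} (hv : Dense (Submodule.span 𝕜 (Set.range v) : Set E)) :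
    (∃ T : E →L[𝕜] F, (∀ i, T (v i) = w i) ∧ ‖T‖ ≤ 1) ↔
      (Matrix.gram 𝕜 v - Matrix.gram 𝕜 w).PosSemidef := by
  rw [posSemidef_gram_sub_gram_iff]
  constructor
  · rintro ⟨T, hT, hnorm⟩ x
    simpa only [apply_linearCombination_of_apply_eq hT, one_mul] using
      T.le_of_opNorm_le hnorm (Finsupp.linearCombination 𝕜 v x)
  · intro h
    have hd := denseRange_linearCombination_iff.2 hv
    refine ⟨(Finsupp.linearCombination 𝕜 w).extendOfNorm (Finsupp.linearCombination 𝕜 v),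
      fun i => ?_, LinearMap.opNorm_extendOfNorm_le hd zero_le_one (by simpa only [one_mul])⟩
    have hext := LinearMap.extendOfNorm_eq hd ⟨1, by simpa only [one_mul]⟩ (Finsupp.single i 1)
    rwa [Finsupp.linearCombination_single, Finsupp.linearCombination_single, one_smul,
      one_smul] at hext

theorem exists_linearIsometry_of_gram_eq [CompleteSpace F] {v : ι → E} {w : ι → F}
    (hv : Dense (Submodule.span 𝕜 (Set.range v) : Set E)) (h : Matrix.gram 𝕜 v = Matrix.gram 𝕜 w) :
    ∃ V : E →ₗᵢ[𝕜] F, ∀ i, V (v i) = w i := by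
  obtain ⟨V, hV, -⟩ := (exists_opNorm_le_one_iff_posSemidef_gram_sub_gram (w := w) hv).2
    (by rw [h, sub_self]; exact .zero)
  have hnorm (x : E) : ‖V x‖ = ‖x‖ := by
    refine (denseRange_linearCombination_iff.2 hv).induction_on (p := fun x => ‖V x‖ = ‖x‖) x
      (isClosed_eq (by fun_prop) (by fun_prop)) fun x => ?_
    rw [apply_linearCombination_of_apply_eq hV, ← sq_eq_sq₀ (norm_nonneg _) (norm_nonneg _),
      ← RCLike.ofReal_inj (K := 𝕜), ← sum_star_mul_gram_mul, ← sum_star_mul_gram_mul, h]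
  exact ⟨⟨V, hnorm⟩, hV⟩

end Gram

section Equicontinuity

variable {𝕜 E F ι : Type*} [NontriviallyNormedField 𝕜] [NormedAddCommGroup E] [NormedSpace 𝕜 E]
  [NormedAddCommGroup F] [NormedSpace 𝕜 F] {l : Filter ι}

theorem tendsto_apply_of_dense_span {A : ι → E →L[𝕜] F} {B : E →L[𝕜] F} {s : Set E}
    (hs : Dense (Submodule.span 𝕜 s : Set E)) (hA : Equicontinuous fun i => ⇑(A i))
    (h : ∀ x ∈ s, Tendsto (fun i => A i x) l (𝓝 (B x))) (x : E) :
    Tendsto (fun i => A i x) l (𝓝 (B x)) := by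
  refine hs.induction (P := fun x => Tendsto (fun i => A i x) l (𝓝 (B x))) ?_
    (hA.isClosed_setOfPred_tendsto B.continuous) x
  intro x hx
  induction hx using Submodule.span_induction with
  | mem x hx => exact h x hx
  | zero => simpa only [map_zero] using tendsto_const_nhds
  | add x y _ _ hx hy => simpa only [map_add] using hx.add hy
  | smul c x _ hx => simpa only [map_smul] using hx.const_smul c

theorem tendstoUniformlyOn_of_equicontinuous {X Y : Type*} [TopologicalSpace X] [UniformSpace Y]
    {f : ι → X → Y} {g : X → Y} {K : Set X} (hK : IsCompact K) (hf : Equicontinuous f)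
    (h : ∀ x ∈ K, Tendsto (fun i => f i x) l (𝓝 (g x))) : TendstoUniformlyOn f g l K := by
  have := (EquicontinuousOn.tendsto_uniformOnFun_iff_pi' (𝔖 := {K}) (by simpa) (F := f)
    (fun _ _ => hf.equicontinuousOn _) l g).2
    (tendsto_pi_nhds.2 fun x => h x (by simpa using x.2))
  exact UniformOnFun.tendsto_iff_tendstoUniformlyOn.1 this K rfl

end Equicontinuity

section CommutingIsometries

variable {𝕜 E ι : Type*} [RCLike 𝕜] [NormedAddCommGroup E] [InnerProductSpace 𝕜 E]
  [CompleteSpace E] {l : Filter ι}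

theorem equicontinuous_adjoint_linearIsometry (V : ι → E →ₗᵢ[𝕜] E) :
    Equicontinuous fun i => ⇑((V i).toContinuousLinearMap†) := by
  refine (LipschitzWith.uniformEquicontinuous _ 1 fun i =>
    ((V i).toContinuousLinearMap†).lipschitz.weaken ?_).equicontinuous
  simpa [← NNReal.coe_le_coe] using (V i).norm_toContinuousLinearMap_le

theorem adjoint_apply_linearIsometry (V : E →ₗᵢ[𝕜] E) (x : E) :
    (V.toContinuousLinearMap†) (V x) = x :=
  ext_inner_right 𝕜 fun y => (adjoint_inner_left _ _ _).trans (V.inner_map_map x y)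

theorem eq_zero_of_isCompactOperator_of_commute_adjoint [l.NeBot] {T : E →L[𝕜] E}
    (hT : IsCompactOperator T) {V : ι → E →ₗᵢ[𝕜] E}
    (hcomm : ∀ i, Commute T ((V i).toContinuousLinearMap†))
    (hV : ∀ x, Tendsto (fun i => ((V i).toContinuousLinearMap†) x) l (𝓝 0)) : T = 0 := by
  ext x
  obtain ⟨K, hK, hTK⟩ := IsCompactOperator.image_closedBall_subset_compact
    (f := (T : E →ₗ[𝕜] E)) hT ‖x‖
  have hunif : TendstoUniformlyOn (fun i => ⇑((V i).toContinuousLinearMap†)) 0 l K :=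
    tendstoUniformlyOn_of_equicontinuous hK (equicontinuous_adjoint_linearIsometry V)
      fun y _ => hV y
  have hmem (i : ι) : T (V i x) ∈ K := hTK ⟨V i x, by simp, rfl⟩
  have hTx (i : ι) : ((V i).toContinuousLinearMap†) (T (V i x)) = T x :=
    (DFunLike.congr_fun (hcomm i).eq (V i x)).symm.trans
      (congrArg T (adjoint_apply_linearIsometry (V i) x))
  refine norm_le_zero_iff.1 (le_of_forall_pos_lt_add fun ε hε => ?_)
  obtain ⟨i, hi⟩ := (Metric.tendstoUniformlyOn_iff.1 hunif ε hε).exists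
  simpa [hTx] using hi _ (hmem i)

end CommutingIsometries

theorem exists_complex_polynomial_near_of_continuousOn {a b : ℝ} {f : ℝ → ℂ}
    (hf : ContinuousOn f (Set.Icc a b)) {ε : ℝ} (hε : 0 < ε) :
    ∃ p : ℂ[X], ∀ x ∈ Set.Icc a b, ‖p.eval (x : ℂ) - f x‖ < ε := by
  obtain ⟨p, hp⟩ := exists_polynomial_near_of_continuousOn a b (fun x => (f x).re)
    (by fun_prop) (ε / 2) (half_pos hε)
  obtain ⟨q, hq⟩ := exists_polynomial_near_of_continuousOn a b (fun x => (f x).im)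
    (by fun_prop) (ε / 2) (half_pos hε)
  have eval_ofReal (r : ℝ[X]) (x : ℝ) : (r.map Complex.ofRealHom).eval (x : ℂ) = (r.eval x : ℝ) :=
    r.eval_map_apply (f := Complex.ofRealHom) x
  refine ⟨p.map Complex.ofRealHom + Polynomial.C Complex.I * q.map Complex.ofRealHom,
    fun x hx => ?_⟩
  rw [Polynomial.eval_add, Polynomial.eval_mul, Polynomial.eval_C, eval_ofReal, eval_ofReal]
  calc ‖((p.eval x : ℝ) + Complex.I * (q.eval x : ℝ) - f x : ℂ)‖
      ≤ |p.eval x - (f x).re| + |q.eval x - (f x).im| := by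
        simpa using Complex.norm_le_abs_re_add_abs_im
          ((p.eval x : ℝ) + Complex.I * (q.eval x : ℝ) - f x : ℂ)
    _ < ε := by linarith [hp x hx, hq x hx]

theorem sum_smul_monomialL2_ae_eq (p : ℂ[X]) :
    (p.sum fun n a => a • monomialL2 n : L2unit) =ᵐ[unitMeasure] fun x => p.eval (x : ℂ) := by
  induction p using Polynomial.induction_on' with
  | add p q hp hq =>
    rw [Polynomial.sum_add_index p q (fun n a => a • monomialL2 n) (fun _ => zero_smul ℂ _)
      (fun _ _ _ => add_smul _ _ _)]
    filter_upwards [Lp.coeFn_add (p.sum fun n a => a • monomialL2 n)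
      (q.sum fun n a => a • monomialL2 n), hp, hq] with x hadd hpx hqx
    rw [hadd, Pi.add_apply, hpx, hqx, Polynomial.eval_add]
  | monomial n a =>
    rw [Polynomial.sum_monomial_index a _ (zero_smul ℂ _)]
    filter_upwards [Lp.coeFn_smul a (monomialL2 n), (memLp_monomial n).coeFn_toLp] with x hsmul hx
    rw [hsmul, Pi.smul_apply, monomialL2, hx, Polynomial.eval_monomial, smul_eq_mul]

theorem dense_span_range_monomialL2 :
    Dense (Submodule.span ℂ (Set.range monomialL2) : Set L2unit) := by
  refine dense_closure.1 ((BoundedContinuousFunction.toLp_denseRange (p := 2) ℂ unitMeasure ℂ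
    ENNReal.ofNat_ne_top).mono ?_)
  rintro _ ⟨g, rfl⟩
  refine Metric.mem_closure_iff.2 fun ε hε => ?_
  obtain ⟨p, hp⟩ := exists_complex_polynomial_near_of_continuousOn (a := 0) (b := 1)
    g.continuous.continuousOn (half_pos hε)
  refine ⟨p.sum fun n a => a • monomialL2 n, sum_mem fun n _ =>
    Submodule.smul_mem _ _ (Submodule.subset_span (Set.mem_range_self n)), ?_⟩
  have hbound : ∀ᵐ x ∂unitMeasure, ‖((p.sum fun n a => a • monomialL2 n : L2unit) -
      BoundedContinuousFunction.toLp 2 unitMeasure ℂ g : L2unit) x‖ ≤ ε / 2 := by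
    filter_upwards [Lp.coeFn_sub (p.sum fun n a => a • monomialL2 n)
        (BoundedContinuousFunction.toLp 2 unitMeasure ℂ g), sum_smul_monomialL2_ae_eq p,
      BoundedContinuousFunction.coeFn_toLp 2 unitMeasure ℂ g,
      ae_restrict_mem measurableSet_Icc] with x hsub hpx hgx hx
    rw [hsub, Pi.sub_apply, hpx, hgx]
    exact (hp x hx).le
  rw [dist_comm, dist_eq_norm]
  calc _ ≤ ε / 2 := by
        simpa [measureUnivNNReal] using Lp.norm_le_of_ae_bound (half_pos hε).le hbound
    _ < ε := half_lt_self hε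

/-- The truncation `1_[0,a] x ^ n` of a monomial, as an element of `L²[0,1]`: up to a scalar, the
image of `x ^ n` under the dilation `V_a`. -/
noncomputable def truncatedMonomialL2 (a : ℝ) (n : ℕ) : L2unit :=
  ((memLp_monomial n).indicator (measurableSet_Icc (a := 0) (b := a))).toLp

theorem truncatedMonomialL2_one (n : ℕ) : truncatedMonomialL2 1 n = monomialL2 n := by
  refine MemLp.toLp_congr _ _ ?_
  filter_upwards [ae_restrict_mem measurableSet_Icc] with x hx using Set.indicator_of_mem hx _

theorem inner_truncatedMonomialL2 {a b : ℝ} (ha : 0 ≤ a) (hab : a ≤ b) (hb : b ≤ 1) (m n : ℕ) :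
    ⟪truncatedMonomialL2 b m, truncatedMonomialL2 a n⟫_ℂ =
      (a : ℂ) ^ (m + n + 1) / (1 + m + n) := by
  have hintegrand : (fun x => ⟪truncatedMonomialL2 b m x, truncatedMonomialL2 a n x⟫_ℂ)
      =ᵐ[unitMeasure] (Set.Icc 0 a).indicator fun x => ((x ^ (m + n) : ℝ) : ℂ) := by
    filter_upwards [((memLp_monomial m).indicator measurableSet_Icc).coeFn_toLp,
      ((memLp_monomial n).indicator measurableSet_Icc).coeFn_toLp] with x hm hn
    rw [truncatedMonomialL2, truncatedMonomialL2, hm, hn]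
    by_cases hx : x ∈ Set.Icc 0 a
    · have hxb : x ∈ Set.Icc 0 b := ⟨hx.1, hx.2.trans hab⟩
      simp [hx, hxb, pow_add, mul_comm]
    · simp [hx]
  rw [L2.inner_def, integral_congr_ae hintegrand, integral_indicator measurableSet_Icc,
    Measure.restrict_restrict measurableSet_Icc,
    Set.inter_eq_left.2 (Set.Icc_subset_Icc_right (hab.trans hb)), integral_complex_ofReal,
    integral_Icc_eq_integral_Ioc, ← intervalIntegral.integral_of_le ha, integral_pow]
  push_cast
  ring

theorem inner_monomialL2 (m n : ℕ) : ⟪monomialL2 m, monomialL2 n⟫_ℂ = 1 / (1 + m + n) := by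
  simpa [truncatedMonomialL2_one] using inner_truncatedMonomialL2 zero_le_one le_rfl le_rfl m n

theorem inner_monomialL2_truncatedMonomialL2 {a : ℝ} (ha : 0 ≤ a) (ha1 : a ≤ 1) (m n : ℕ) :
    ⟪monomialL2 m, truncatedMonomialL2 a n⟫_ℂ = (a : ℂ) ^ (m + n + 1) / (1 + m + n) := by
  rw [← truncatedMonomialL2_one, inner_truncatedMonomialL2 ha ha1 le_rfl]

theorem pickMatrix_eq_transpose (c : ℕ → ℂ) :
    pickMatrix c = (Matrix.gram ℂ monomialL2 - Matrix.gram ℂ fun n => c n • monomialL2 n)ᵀ := by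
  ext m n
  simp only [pickMatrix, Matrix.of_apply, Matrix.transpose_apply, Matrix.sub_apply,
    Matrix.gram_apply, inner_smul_left, inner_smul_right, inner_monomialL2, RCLike.star_def]
  ring

theorem exists_extendsDiagonal_norm_le_one_iff (c : ℕ → ℂ) :
    (∃ T : L2unit →L[ℂ] L2unit, ExtendsDiagonal c T ∧ ‖T‖ ≤ 1) ↔ (pickMatrix c).PosSemidef := by
  rw [pickMatrix_eq_transpose, Matrix.posSemidef_transpose_iff]
  exact exists_opNorm_le_one_iff_posSemidef_gram_sub_gram dense_span_range_monomialL2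

theorem ExtendsDiagonal.smul {c : ℕ → ℂ} {T : L2unit →L[ℂ] L2unit} (hT : ExtendsDiagonal c T)
    (a : ℂ) : ExtendsDiagonal (fun n => a * c n) (a • T) := fun n => by
  rw [_root_.smul_apply, hT n, smul_smul]

theorem exists_extendsDiagonal_iff (c : ℕ → ℂ) :
    (∃ T : L2unit →L[ℂ] L2unit, ExtendsDiagonal c T) ↔
      ∃ M : ℝ, 0 < M ∧ (pickMatrix fun n => c n / (M : ℂ)).PosSemidef := by
  simp only [← exists_extendsDiagonal_norm_le_one_iff]
  constructor
  · rintro ⟨T, hT⟩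
    have hM : 0 < ‖T‖ + 1 := by positivity
    refine ⟨‖T‖ + 1, hM, ((‖T‖ + 1 : ℝ) : ℂ)⁻¹ • T, ?_, ?_⟩
    · simpa only [div_eq_inv_mul] using hT.smul _
    · rw [norm_smul, norm_inv, Complex.norm_of_nonneg hM.le, inv_mul_le_one₀ hM]
      exact le_add_of_nonneg_right zero_le_one
  · rintro ⟨M, hM, T, hT, -⟩
    have hM' : (M : ℂ) ≠ 0 := Complex.ofReal_ne_zero.2 hM.ne'
    exact ⟨(M : ℂ) • T, by simpa only [mul_div_cancel₀ _ hM'] using hT.smul (M : ℂ)⟩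

theorem ExtendsDiagonal.commute {c d : ℕ → ℂ} {S T : L2unit →L[ℂ] L2unit}
    (hS : ExtendsDiagonal c S) (hT : ExtendsDiagonal d T) : Commute S T := by
  refine ContinuousLinearMap.ext_on dense_span_range_monomialL2 ?_
  rintro _ ⟨n, rfl⟩
  simp only [mul_def, comp_apply, hS n, hT n, map_smul, smul_comm (c n)]

theorem exists_linearIsometry_adjoint_extendsDiagonal {a : ℝ} (ha : 0 < a) (ha1 : a ≤ 1) :
    ∃ V : L2unit →ₗᵢ[ℂ] L2unit,
      ExtendsDiagonal (fun n => (√a : ℂ) * (a : ℂ) ^ n) (V.toContinuousLinearMap†) := by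
  have hs : (√a : ℂ) ^ 2 = a := by rw [← Complex.ofReal_pow, Real.sq_sqrt ha.le]
  -- `V` is the dilation `f ↦ a^(-1/2) 1_[0,a] f(· / a)`.
  obtain ⟨V, hV⟩ := exists_linearIsometry_of_gram_eq (𝕜 := ℂ) (v := monomialL2)
    (w := fun n => ((√a : ℂ) * (a : ℂ) ^ n)⁻¹ • truncatedMonomialL2 a n)
    dense_span_range_monomialL2 <| by
      ext m n
      simp only [Matrix.gram_apply, inner_smul_left, inner_smul_right, inner_monomialL2,
        inner_truncatedMonomialL2 ha.le le_rfl ha1, map_inv₀, map_mul, map_pow, Complex.conj_ofReal]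
      field_simp
      rw [hs]
      ring
  refine ⟨V, fun n => ?_⟩
  have hinner : innerSL ℂ ((V.toContinuousLinearMap†) (monomialL2 n)) =
      innerSL ℂ (((√a : ℂ) * (a : ℂ) ^ n) • monomialL2 n) := by
    refine ContinuousLinearMap.ext_on dense_span_range_monomialL2 ?_
    rintro _ ⟨m, rfl⟩
    simp only [innerSL_apply_apply, adjoint_inner_left, LinearIsometry.coe_toContinuousLinearMap,
      hV, inner_smul_left, inner_smul_right, inner_monomialL2, map_mul, map_pow,
      Complex.conj_ofReal, inner_monomialL2_truncatedMonomialL2 ha.le ha1]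
    field_simp
    rw [hs]
    ring
  exact innerSL_inj.1 hinner

theorem ExtendsDiagonal.eq_zero_of_isCompactOperator {c : ℕ → ℂ} {T : L2unit →L[ℂ] L2unit}
    (hT : ExtendsDiagonal c T) (hc : IsCompactOperator T) : T = 0 := by
  choose V hV using fun k : ℕ => exists_linearIsometry_adjoint_extendsDiagonal
    (Nat.one_div_pos_of_nat (α := ℝ) (n := k))
    (div_le_one_of_le₀ (le_add_of_nonneg_left k.cast_nonneg) k.cast_add_one_pos.le)
  refine eq_zero_of_isCompactOperator_of_commute_adjoint (l := atTop) hc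
    (fun k => hT.commute (hV k)) (tendsto_apply_of_dense_span (B := 0)
      dense_span_range_monomialL2 (equicontinuous_adjoint_linearIsometry V) ?_)
  rintro _ ⟨n, rfl⟩
  have hcont : Continuous fun t : ℝ => ((√t : ℂ) * (t : ℂ) ^ n) • monomialL2 n := by fun_prop
  simpa [hV _ n, Function.comp_def] using
    (hcont.tendsto 0).comp tendsto_one_div_add_atTop_nhds_zero_nat

theorem theorem3p2 (c : ℕ → ℂ) :
    ((∃ T : L2unit →L[ℂ] L2unit, ExtendsDiagonal c T ∧ ‖T‖ ≤ 1) ↔ (pickMatrix c).PosSemidef) ∧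
    ((∃ T : L2unit →L[ℂ] L2unit, ExtendsDiagonal c T) ↔
      ∃ M : ℝ, 0 < M ∧ (pickMatrix fun n => c n / (M : ℂ)).PosSemidef) ∧
    (∀ T : L2unit →L[ℂ] L2unit, ExtendsDiagonal c T → T ≠ 0 → ¬ IsCompactOperator T) :=
  ⟨exists_extendsDiagonal_norm_le_one_iff c, exists_extendsDiagonal_iff c,
    fun _ hT hT0 hc => hT0 (hT.eq_zero_of_isCompactOperator hc)⟩
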